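/- Corollary 3 (Critical density under single-slope path loss). Let $\alpha_0>2$ be the path loss exponent, $\tau>0$ the decoding threshold, $N_a\ge 1$ the number of antennas per base station (BS), and let $\Delta h>0$ be the antenna height difference between BSs and users. Put $\tau^\dagger=\tau/N_a$, $\omega_1(x,y)={}_2F_1\left(1,1-\frac2y;2-\frac2y;-x\right)$ (Gaussian hypergeometric function) and $\delta=\frac{2\tau^\dagger\omega_1(\tau^\dagger,\alpha_0)}{\alpha_0-2}$. Under the single-slope path loss model $x\mapsto x^{-\alpha_0}$, the approximate coverage probability (CP) and the approximate spatial throughput (ST) of the multi-antenna (MISO) network at BS density $\lambda>0$ are $$\widetilde{\mathsf{CP}}(\lambda)=\frac{1}{1+\delta}\exp\left(-\pi\lambda\,\delta\,\Delta h^2\right),\qquad \widetilde{\mathsf{ST}}(\lambda)=\lambda\,\widetilde{\mathsf{CP}}(\lambda)\log_2(1+\tau).$$ (1) Without a CP constraint, the critical density, i.e. the density that maximizes $\widetilde{\mathsf{ST}}$ over all $\lambda>0$ and beyond which $\widetilde{\mathsf{ST}}$ is strictly decreasing, exists, is unique and equals $$\lambda_1^\dagger=\frac{\alpha_0-2}{2\pi\tau^\dagger\omega_1(\tau^\dagger,\alpha_0)\,\Delta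 h^2}.$$ (2) Let $\varepsilon>0$. The requirement $\widetilde{\mathsf{CP}}(\lambda)>\varepsilon$ holds for some $\lambda>0$ if and only if $\delta<\varepsilon^{-1}-1$. In that case the critical density under the CP constraint $\varepsilon$ exists, is unique and equals $$\lambda_1^*=\min\left(\lambda_1^\dagger\ln\left[\varepsilon^{-1}\left(1+\frac{2\tau^\dagger\omega_1(\tau^\dagger,\alpha_0)}{\alpha_0-2}\right)^{-1}\right],\ \lambda_1^\dagger\right).$$ Here the critical density under the constraint is the maximizer of $\widetilde{\mathsf{ST}}$ over $\{\lambda>0:\widetilde{\mathsf{CP}}(\lambda)\ge\varepsilon\}$. The same value is obtained with the strict constraint $\widetilde{\mathsf{CP}}(\lambda)>\varepsilon$, whose feasible set need not contain a maximizer: $\lambda_1^*$ is the unique positive density in the closure of the feasible set at which $\widetilde{\mathsf{ST}}$ equals its supremum over the feasible set. (3) Both critical densities are inversely proportional to $\Delta h^2$: for fixed $\alpha_0,\tau,N_a$ (and, for the second, fixed $\varepsilon>0$ with $\delta<\varepsilon^{-1}-1$) there are constants $c^\dagger,c^*>0$ not depending on $\Delta h$ with $\lambda_1^\dagger=c^\dagger/\Delta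 h^2$ and $\lambda_1^*=c^*/\Delta h^2$ for all $\Delta h>0$. -/

import Mathlib

noncomputable section

/-- The Gaussian hypergeometric function `₂F₁(a, b; c; z)` for real parameters `0 < b < c` and
real `z < 1`, in Euler's integral form. (The power series converges only for `|z| < 1`, while the
arguments `z = -x` with arbitrary `x > 0` are needed.) -/
def gaussHypergeometric (a b c z : ℝ) : ℝ :=
  Real.Gamma c / (Real.Gamma b * Real.Gamma (c - b)) *
    ∫ t in (0 : ℝ)..1, t ^ (b - 1) * (1 - t) ^ (c - b - 1) * (1 - z * t) ^ (-a)

/-- `ω₁(x, y) = ₂F₁(1, 1 - 2/y; 2 - 2/y; -x)`. -/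
def omega₁ (x y : ℝ) : ℝ :=
  gaussHypergeometric 1 (1 - 2 / y) (2 - 2 / y) (-x)

/-- `δ(x, y) = 2 x ω₁(x, y) / (y - 2)`. -/
def delta (x y : ℝ) : ℝ :=
  2 * x * omega₁ x y / (y - 2)

/-- The normalized decoding threshold `τ† = τ / Nₐ`. -/
def tauDagger (τ : ℝ) (Na : ℕ) : ℝ := τ / Na

/-- The approximate MISO coverage probability under single-slope path loss `x ↦ x ^ (-α₀)`, at
base station density `lam`, with antenna height difference `Δh`. -/
def approxCP (τ : ℝ) (Na : ℕ) (α₀ Δh lam : ℝ) : ℝ :=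
  1 / (1 + delta (tauDagger τ Na) α₀) *
    Real.exp (-Real.pi * lam * delta (tauDagger τ Na) α₀ * Δh ^ 2)

/-- The approximate MISO spatial throughput under single-slope path loss. -/
def approxST (τ : ℝ) (Na : ℕ) (α₀ Δh lam : ℝ) : ℝ :=
  lam * approxCP τ Na α₀ Δh lam * Real.logb 2 (1 + τ)

/-- `l` is the critical density of the throughput `ST`: among all positive densities it maximizes
`ST`, and beyond it `ST` diminishes. -/
def IsCriticalDensity (ST : ℝ → ℝ) (l : ℝ) : Prop :=
  0 < l ∧ IsMaxOn ST (Set.Ioi 0) l ∧ StrictAntiOn ST (Set.Ici l)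

/-- `l` maximizes the throughput `ST` among all positive densities whose coverage probability is
at least `ε`. -/
def IsConstrainedCriticalDensity (CP ST : ℝ → ℝ) (ε l : ℝ) : Prop :=
  l ∈ {x : ℝ | 0 < x ∧ ε ≤ CP x} ∧ IsMaxOn ST {x : ℝ | 0 < x ∧ ε ≤ CP x} l

/-- The version of the constrained critical density for the strict requirement `ε < CP x`: the
feasible set need not contain a maximizer, so `l` is a positive density that is feasible or a limit
of feasible ones, and `ST l` is the supremum of the throughput over the feasible densities. -/
def IsStrictConstrainedCriticalDensity (CP ST : ℝ → ℝ) (ε l : ℝ) : Prop :=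
  0 < l ∧ l ∈ closure {x : ℝ | 0 < x ∧ ε < CP x} ∧
    IsLUB (ST '' {x : ℝ | 0 < x ∧ ε < CP x}) (ST l)

/-- The closed form of the critical density without coverage requirement. -/
def lambdaDagger (τ : ℝ) (Na : ℕ) (α₀ Δh : ℝ) : ℝ :=
  (α₀ - 2) / (2 * Real.pi * tauDagger τ Na * omega₁ (tauDagger τ Na) α₀ * Δh ^ 2)

/-- The closed form of the critical density with coverage requirement `ε`. -/
def lambdaStar (τ : ℝ) (Na : ℕ) (α₀ Δh ε : ℝ) : ℝ :=
  min
    (lambdaDagger τ Na α₀ Δh *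
      Real.log (ε⁻¹ * (1 + 2 * tauDagger τ Na * omega₁ (tauDagger τ Na) α₀ / (α₀ - 2))⁻¹))
    (lambdaDagger τ Na α₀ Δh)

end

open Set MeasureTheory

/-! ### Positivity of the hypergeometric factor -/

/-! Put `a = π δ Δh²`. The throughput is `K x exp (-a x)` with `K > 0`, strictly increasing on `(0,
a⁻¹]` and strictly decreasing afterwards, and `a⁻¹` is `lambdaDagger`. Coverage decreases in the
density, so the constraint cuts out `(0, M]`, or `(0, M)` if strict, with `M = a⁻¹ log (ε⁻¹ (1 +
δ)⁻¹)`; the optimum moves to `min M a⁻¹` (`mul_exp_neg_lt_min`). The hypergeometric factor matters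
only through its sign, which gives `δ > 0`; `Δh` enters only through `a`, hence the scaling. -/

/-- For `c = b + 1` the factor in `1 - t` of Euler's integrand has exponent `0`. What remains is
positive on `(0, 1)`, and integrable because `b - 1 > -1`. -/
theorem gaussHypergeometric_pos {b z : ℝ} (hb : 0 < b) (hz : z ≤ 0) :
    0 < gaussHypergeometric 1 b (b + 1) z := by
  unfold gaussHypergeometric
  have hden : ∀ t ∈ Icc (0 : ℝ) 1, 0 < 1 - z * t := fun t ht => by
    nlinarith [mul_nonneg (neg_nonneg.2 hz) ht.1]
  refine mul_pos (div_pos (Real.Gamma_pos_of_pos (by linarith))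
    (mul_pos (Real.Gamma_pos_of_pos hb) (Real.Gamma_pos_of_pos (by linarith)))) ?_
  simp only [add_sub_cancel_left, sub_self, Real.rpow_zero, mul_one]
  refine intervalIntegral.intervalIntegral_pos_of_pos_on ?_ (fun t ht => ?_) one_pos
  · refine (intervalIntegral.intervalIntegrable_rpow' (by linarith)).mul_continuousOn ?_
    rw [uIcc_of_le zero_le_one]
    exact ContinuousOn.rpow_const (by fun_prop) fun t ht => Or.inl (hden t ht).ne'
  · exact mul_pos (Real.rpow_pos_of_pos ht.1 _)
      (Real.rpow_pos_of_pos (hden t (Ioo_subset_Icc_self ht)) _)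

theorem omega₁_pos {x y : ℝ} (hx : 0 ≤ x) (hy : 2 < y) : 0 < omega₁ x y := by
  have h : 0 < 1 - 2 / y := by
    rw [sub_pos, div_lt_one (by linarith)]
    exact hy
  have h' : 2 - 2 / y = (1 - 2 / y) + 1 := by ring
  rw [omega₁, h']
  exact gaussHypergeometric_pos h (by linarith)

theorem delta_pos {x y : ℝ} (hx : 0 < x) (hy : 2 < y) : 0 < delta x y :=
  div_pos (mul_pos (by positivity) (omega₁_pos hx.le hy)) (by linarith)

/-! ### The function `x ↦ K x exp (-a x)` -/

/-- No derivative is needed: `1 + u < exp u` at `u = -a (y - x)` gives `y exp u > y - a y (y - x) ≥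
x`, as `a y ≤ 1`. -/
theorem mul_exp_neg_strictMonoOn {K a : ℝ} (hK : 0 < K) (ha : 0 < a) :
    StrictMonoOn (fun x => K * (x * Real.exp (-(a * x)))) (Ioc 0 a⁻¹) := by
  intro x hx y hy hxy
  have hay : a * y ≤ 1 := by
    have := mul_le_mul_of_nonneg_left hy.2 ha.le
    rwa [mul_inv_cancel₀ ha.ne'] at this
  have h := Real.add_one_lt_exp (x := -(a * (y - x)))
    (neg_ne_zero.2 (mul_pos ha (sub_pos.2 hxy)).ne')
  have hlt : x < y * Real.exp (-(a * (y - x))) := by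
    nlinarith [mul_lt_mul_of_pos_left h hy.1, mul_nonneg (sub_nonneg.2 hay) (sub_pos.2 hxy).le]
  have hsplit : Real.exp (-(a * y)) = Real.exp (-(a * (y - x))) * Real.exp (-(a * x)) := by
    rw [← Real.exp_add]; ring_nf
  refine mul_lt_mul_of_pos_left ?_ hK
  rw [hsplit, ← mul_assoc]
  exact mul_lt_mul_of_pos_right hlt (Real.exp_pos _)

theorem mul_exp_neg_strictAntiOn {K a : ℝ} (hK : 0 < K) (ha : 0 < a) :
    StrictAntiOn (fun x => K * (x * Real.exp (-(a * x)))) (Ici a⁻¹) := by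
  intro x hx y hy hxy
  have hx0 : 0 < x := (inv_pos.2 ha).trans_le hx
  have hax : 1 ≤ a * x := by
    have := mul_le_mul_of_nonneg_left (mem_Ici.1 hx) ha.le
    rwa [mul_inv_cancel₀ ha.ne'] at this
  have h := Real.add_one_lt_exp (x := a * (y - x)) (mul_pos ha (sub_pos.2 hxy)).ne'
  have hlt : y < x * Real.exp (a * (y - x)) := by
    nlinarith [mul_lt_mul_of_pos_left h hx0, mul_nonneg (sub_nonneg.2 hax) (sub_pos.2 hxy).le]
  have hsplit : Real.exp (-(a * x)) = Real.exp (a * (y - x)) * Real.exp (-(a * y)) := by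
    rw [← Real.exp_add]; ring_nf
  refine mul_lt_mul_of_pos_left ?_ hK
  rw [hsplit, ← mul_assoc]
  exact mul_lt_mul_of_pos_right hlt (Real.exp_pos _)

/-- On `(0, M]` the function `x ↦ K x exp (-a x)` has its strict maximum at `min M a⁻¹`. -/
theorem mul_exp_neg_lt_min {K a M x : ℝ} (hK : 0 < K) (ha : 0 < a) (hx : 0 < x) (hxM : x ≤ M)
    (hne : x ≠ min M a⁻¹) :
    K * (x * Real.exp (-(a * x))) < K * (min M a⁻¹ * Real.exp (-(a * min M a⁻¹))) := by
  have hp : 0 < min M a⁻¹ := lt_min (hx.trans_le hxM) (inv_pos.2 ha)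
  rcases hne.lt_or_gt with h | h
  · exact mul_exp_neg_strictMonoOn hK ha ⟨hx, h.le.trans (min_le_right _ _)⟩
      ⟨hp, min_le_right _ _⟩ h
  · have hm : min M a⁻¹ = a⁻¹ := by
      rcases min_choice M a⁻¹ with hc | hc
      · exact absurd (h.trans_le hxM) (by rw [hc]; exact lt_irrefl _)
      · exact hc
    rw [hm] at h ⊢
    exact mul_exp_neg_strictAntiOn hK ha self_mem_Ici h.le h

theorem isMaxOn_mul_exp_neg {K a M : ℝ} (hK : 0 < K) (ha : 0 < a) :
    IsMaxOn (fun x => K * (x * Real.exp (-(a * x)))) (Ioc 0 M) (min M a⁻¹) := by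
  intro x hx
  rcases eq_or_ne x (min M a⁻¹) with h | h
  · exact (congrArg (fun x => K * (x * Real.exp (-(a * x)))) h).le
  · exact (mul_exp_neg_lt_min hK ha hx.1 hx.2 h).le

theorem isCriticalDensity_mul_exp_neg_iff {K a l : ℝ} (hK : 0 < K) (ha : 0 < a) :
    IsCriticalDensity (fun x => K * (x * Real.exp (-(a * x)))) l ↔ l = a⁻¹ := by
  have ha' : 0 < a⁻¹ := inv_pos.2 ha
  constructor
  · rintro ⟨hl, hmax, -⟩
    by_contra hne
    -- Truncating at `max l a⁻¹` keeps both points in the interval, so the bounded case applies.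
    have hmin : min (max l a⁻¹) a⁻¹ = a⁻¹ := min_eq_right (le_max_right _ _)
    have h := mul_exp_neg_lt_min hK ha hl (le_max_left l a⁻¹) (by rwa [hmin])
    rw [hmin] at h
    exact h.not_ge (hmax ha')
  · rintro rfl
    refine ⟨ha', fun x hx => ?_, mul_exp_neg_strictAntiOn hK ha⟩
    have h := isMaxOn_mul_exp_neg (M := max x a⁻¹) hK ha ⟨hx, le_max_left _ _⟩
    rwa [min_eq_right (le_max_right _ _)] at h

theorem isConstrainedCriticalDensity_mul_exp_neg_iff {CP : ℝ → ℝ} {K a M ε l : ℝ} (hK : 0 < K)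
    (ha : 0 < a) (hM : 0 < M) (hCP : ∀ x, ε ≤ CP x ↔ x ≤ M) :
    IsConstrainedCriticalDensity CP (fun x => K * (x * Real.exp (-(a * x)))) ε l ↔
      l = min M a⁻¹ := by
  have hset : {x : ℝ | 0 < x ∧ ε ≤ CP x} = Ioc 0 M := by
    ext x
    simp [hCP]
  have hp : min M a⁻¹ ∈ Ioc 0 M := ⟨lt_min hM (inv_pos.2 ha), min_le_left _ _⟩
  rw [IsConstrainedCriticalDensity, hset]
  constructor
  · rintro ⟨hl, hmax⟩
    by_contra hne
    exact (mul_exp_neg_lt_min hK ha hl.1 hl.2 hne).not_ge (hmax hp)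
  · rintro rfl
    exact ⟨hp, isMaxOn_mul_exp_neg hK ha⟩

/-- By continuity the supremum over `(0, M)` is the maximum over `(0, M]`, even when it sits at `M`.
Any other positive point of the closure has a strictly smaller value. -/
theorem isStrictConstrainedCriticalDensity_mul_exp_neg_iff {CP : ℝ → ℝ} {K a M ε l : ℝ}
    (hK : 0 < K) (ha : 0 < a) (hM : 0 < M) (hCP : ∀ x, ε < CP x ↔ x < M) :
    IsStrictConstrainedCriticalDensity CP (fun x => K * (x * Real.exp (-(a * x)))) ε l ↔
      l = min M a⁻¹ := by
  have hset : {x : ℝ | 0 < x ∧ ε < CP x} = Ioo 0 M := by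
    ext x
    simp [hCP]
  have hp : 0 < min M a⁻¹ := lt_min hM (inv_pos.2 ha)
  have hpcl : min M a⁻¹ ∈ closure (Ioo 0 M) := by
    rw [closure_Ioo hM.ne]
    exact ⟨hp.le, min_le_left _ _⟩
  have hcont : Continuous fun x => K * (x * Real.exp (-(a * x))) := by fun_prop
  have hlub : IsLUB ((fun x => K * (x * Real.exp (-(a * x)))) '' Ioo 0 M)
      (K * (min M a⁻¹ * Real.exp (-(a * min M a⁻¹)))) := by
    refine isLUB_of_mem_closure ?_ (image_closure_subset_closure_image hcont ⟨_, hpcl, rfl⟩)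
    rintro _ ⟨x, hx, rfl⟩
    exact isMaxOn_mul_exp_neg hK ha ⟨hx.1, hx.2.le⟩
  rw [IsStrictConstrainedCriticalDensity, hset]
  constructor
  · rintro ⟨hl, hlcl, hl'⟩
    rw [closure_Ioo hM.ne] at hlcl
    by_contra hne
    exact (mul_exp_neg_lt_min hK ha hl hlcl.2 hne).ne (hl'.unique hlub)
  · rintro rfl
    exact ⟨hp, hpcl, hlub⟩

/-! ### The coverage constraint -/

theorem lt_inv_mul_exp_neg_iff {a b ε x : ℝ} (ha : 0 < a) (hb : 0 < b) (hε : 0 < ε) :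
    ε < 1 / b * Real.exp (-(a * x)) ↔ x < a⁻¹ * Real.log (ε⁻¹ * b⁻¹) := by
  rw [inv_mul_eq_div, lt_div_iff₀ ha, Real.lt_log_iff_exp_lt (by positivity), Real.exp_neg,
    mul_comm x a, one_div, ← div_eq_mul_inv, ← div_eq_mul_inv, lt_div_iff₀ (Real.exp_pos _),
    lt_div_iff₀ hb, mul_comm (Real.exp _) b, inv_eq_one_div b, inv_eq_one_div ε,
    lt_div_iff₀ hb, lt_div_iff₀ hε]
  constructor <;> intro h <;> linarith

theorem le_inv_mul_exp_neg_iff {a b ε x : ℝ} (ha : 0 < a) (hb : 0 < b) (hε : 0 < ε) :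
    ε ≤ 1 / b * Real.exp (-(a * x)) ↔ x ≤ a⁻¹ * Real.log (ε⁻¹ * b⁻¹) := by
  rw [inv_mul_eq_div, le_div_iff₀ ha, Real.le_log_iff_exp_le (by positivity), Real.exp_neg,
    mul_comm x a, one_div, ← div_eq_mul_inv, ← div_eq_mul_inv, le_div_iff₀ (Real.exp_pos _),
    le_div_iff₀ hb, mul_comm (Real.exp _) b, inv_eq_one_div b, inv_eq_one_div ε,
    le_div_iff₀ hb, le_div_iff₀ hε]
  constructor <;> intro h <;> linarith

theorem log_inv_mul_inv_pos_iff {d ε : ℝ} (hd : 0 < d) (hε : 0 < ε) :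
    0 < Real.log (ε⁻¹ * (1 + d)⁻¹) ↔ d < ε⁻¹ - 1 := by
  rw [Real.log_pos_iff (by positivity), ← div_eq_mul_inv, one_lt_div (by positivity),
    lt_sub_iff_add_lt']

/-! ### The closed forms -/

theorem lambdaDagger_eq_inv (τ : ℝ) (Na : ℕ) (α₀ Δh : ℝ) :
    lambdaDagger τ Na α₀ Δh = (Real.pi * delta (tauDagger τ Na) α₀ * Δh ^ 2)⁻¹ := by
  rw [lambdaDagger, delta, mul_div_assoc', div_mul_eq_mul_div, inv_div]
  ring_nf

theorem lambdaDagger_eq_div_sq (τ : ℝ) (Na : ℕ) (α₀ Δh : ℝ) :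
    lambdaDagger τ Na α₀ Δh = lambdaDagger τ Na α₀ 1 / Δh ^ 2 := by
  rw [lambdaDagger_eq_inv, lambdaDagger_eq_inv, one_pow, mul_one, mul_inv, div_eq_mul_inv]

theorem lambdaStar_eq_min_inv (τ : ℝ) (Na : ℕ) (α₀ Δh ε : ℝ) :
    lambdaStar τ Na α₀ Δh ε =
      min ((Real.pi * delta (tauDagger τ Na) α₀ * Δh ^ 2)⁻¹ *
          Real.log (ε⁻¹ * (1 + delta (tauDagger τ Na) α₀)⁻¹))
        (Real.pi * delta (tauDagger τ Na) α₀ * Δh ^ 2)⁻¹ := by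
  rw [lambdaStar, lambdaDagger_eq_inv]
  rfl

theorem lambdaStar_eq_div_sq (τ : ℝ) (Na : ℕ) (α₀ Δh ε : ℝ) :
    lambdaStar τ Na α₀ Δh ε = lambdaStar τ Na α₀ 1 ε / Δh ^ 2 := by
  rw [lambdaStar, lambdaStar, lambdaDagger_eq_div_sq, div_mul_eq_mul_div,
    min_div_div_right (sq_nonneg Δh)]

theorem approxCP_eq (τ : ℝ) (Na : ℕ) (α₀ Δh x : ℝ) :
    approxCP τ Na α₀ Δh x = 1 / (1 + delta (tauDagger τ Na) α₀) *
      Real.exp (-(Real.pi * delta (tauDagger τ Na) α₀ * Δh ^ 2 * x)) := by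
  rw [approxCP]
  ring_nf

theorem approxST_eq (τ : ℝ) (Na : ℕ) (α₀ Δh : ℝ) :
    approxST τ Na α₀ Δh = fun x => Real.logb 2 (1 + τ) / (1 + delta (tauDagger τ Na) α₀) *
      (x * Real.exp (-(Real.pi * delta (tauDagger τ Na) α₀ * Δh ^ 2 * x))) := by
  funext x
  rw [approxST, approxCP_eq]
  ring

theorem corollary3 (τ : ℝ) (Na : ℕ) (α₀ : ℝ) (hτ : 0 < τ) (hNa : 1 ≤ Na) (hα : 2 < α₀) :
    -- the critical density without coverage requirement
    (∀ Δh : ℝ, 0 < Δh → ∀ l : ℝ,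
      IsCriticalDensity (approxST τ Na α₀ Δh) l ↔ l = lambdaDagger τ Na α₀ Δh) ∧
    -- the critical density with coverage requirement `ε`, and when the requirement can be met
    (∀ ε : ℝ, 0 < ε → ∀ Δh : ℝ, 0 < Δh →
      ((∃ x : ℝ, 0 < x ∧ ε < approxCP τ Na α₀ Δh x) ↔
        2 * tauDagger τ Na * omega₁ (tauDagger τ Na) α₀ / (α₀ - 2) < ε⁻¹ - 1) ∧
      (2 * tauDagger τ Na * omega₁ (tauDagger τ Na) α₀ / (α₀ - 2) < ε⁻¹ - 1 →
        ∀ l : ℝ,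
          (IsConstrainedCriticalDensity (approxCP τ Na α₀ Δh) (approxST τ Na α₀ Δh) ε l ↔
            l = lambdaStar τ Na α₀ Δh ε) ∧
          (IsStrictConstrainedCriticalDensity (approxCP τ Na α₀ Δh) (approxST τ Na α₀ Δh) ε l ↔
            l = lambdaStar τ Na α₀ Δh ε))) ∧
    -- both critical densities are inversely proportional to `Δh ^ 2`
    (∃ c : ℝ, 0 < c ∧ ∀ Δh : ℝ, 0 < Δh → ∀ l : ℝ,
      IsCriticalDensity (approxST τ Na α₀ Δh) l ↔ l = c / Δh ^ 2) ∧
    (∀ ε : ℝ, 0 < ε →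
      2 * tauDagger τ Na * omega₁ (tauDagger τ Na) α₀ / (α₀ - 2) < ε⁻¹ - 1 →
      ∃ c : ℝ, 0 < c ∧ ∀ Δh : ℝ, 0 < Δh → ∀ l : ℝ,
        (IsConstrainedCriticalDensity (approxCP τ Na α₀ Δh) (approxST τ Na α₀ Δh) ε l ↔
          l = c / Δh ^ 2) ∧
        (IsStrictConstrainedCriticalDensity (approxCP τ Na α₀ Δh) (approxST τ Na α₀ Δh) ε l ↔
          l = c / Δh ^ 2)) := by

  have hx : 0 < tauDagger τ Na := div_pos hτ (Nat.cast_pos.2 hNa)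
  have hd : 0 < delta (tauDagger τ Na) α₀ := delta_pos hx hα
  have hb : 0 < 1 + delta (tauDagger τ Na) α₀ := by linarith
  have hK : 0 < Real.logb 2 (1 + τ) / (1 + delta (tauDagger τ Na) α₀) :=
    div_pos (Real.logb_pos one_lt_two (by linarith)) hb
  have ha : ∀ Δh : ℝ, 0 < Δh → 0 < Real.pi * delta (tauDagger τ Na) α₀ * Δh ^ 2 := fun Δh h =>
    mul_pos (mul_pos Real.pi_pos hd) (pow_pos h 2)
  have hcrit : ∀ Δh : ℝ, 0 < Δh → ∀ l : ℝ,
      IsCriticalDensity (approxST τ Na α₀ Δh) l ↔ l = lambdaDagger τ Na α₀ Δh := fun Δh h l => by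
    rw [approxST_eq, lambdaDagger_eq_inv]
    exact isCriticalDensity_mul_exp_neg_iff hK (ha Δh h)
  have hfeas : ∀ ε : ℝ, 0 < ε → ∀ Δh : ℝ, 0 < Δh →
      ((∃ x : ℝ, 0 < x ∧ ε < approxCP τ Na α₀ Δh x) ↔
        delta (tauDagger τ Na) α₀ < ε⁻¹ - 1) := fun ε hε Δh h => by
    simp only [approxCP_eq, lt_inv_mul_exp_neg_iff (ha Δh h) hb hε]
    rw [← log_inv_mul_inv_pos_iff hd hε, ← mul_pos_iff_of_pos_left (inv_pos.2 (ha Δh h))]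
    -- The feasible set is `(0, M)`, nonempty exactly when `0 < M`.
    exact ⟨fun ⟨x, h0, h1⟩ => h0.trans h1, exists_between⟩
  have hcons : ∀ ε : ℝ, 0 < ε → delta (tauDagger τ Na) α₀ < ε⁻¹ - 1 →
      ∀ Δh : ℝ, 0 < Δh → ∀ l : ℝ,
        (IsConstrainedCriticalDensity (approxCP τ Na α₀ Δh) (approxST τ Na α₀ Δh) ε l ↔
          l = lambdaStar τ Na α₀ Δh ε) ∧
        (IsStrictConstrainedCriticalDensity (approxCP τ Na α₀ Δh) (approxST τ Na α₀ Δh) ε l ↔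
          l = lambdaStar τ Na α₀ Δh ε) := fun ε hε hδ Δh h l => by
    have hM := mul_pos (inv_pos.2 (ha Δh h)) ((log_inv_mul_inv_pos_iff hd hε).2 hδ)
    rw [approxST_eq, lambdaStar_eq_min_inv]
    exact ⟨isConstrainedCriticalDensity_mul_exp_neg_iff hK (ha Δh h) hM fun x => by
        rw [approxCP_eq, le_inv_mul_exp_neg_iff (ha Δh h) hb hε],
      isStrictConstrainedCriticalDensity_mul_exp_neg_iff hK (ha Δh h) hM fun x => by
        rw [approxCP_eq, lt_inv_mul_exp_neg_iff (ha Δh h) hb hε]⟩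
  refine ⟨hcrit, fun ε hε Δh h => ⟨hfeas ε hε Δh h, fun hδ => hcons ε hε hδ Δh h⟩,
    ⟨lambdaDagger τ Na α₀ 1, ?_, fun Δh h l => ?_⟩,
    fun ε hε hδ => ⟨lambdaStar τ Na α₀ 1 ε, ?_, fun Δh h l => ?_⟩⟩
  -- The constant is the critical density at `Δh = 1`, so it is positive by definition.
  · exact ((hcrit 1 one_pos _).2 rfl).1
  · rw [← lambdaDagger_eq_div_sq]
    exact hcrit Δh h l
  · exact ((hcons ε hε hδ 1 one_pos _).2.2 rfl).1
  · rw [← lambdaStar_eq_div_sq]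
    exact hcons ε hε hδ Δh h l
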